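/- Conventions. A hyperbolic space is a geodesic metric space $S$ that is Gromov $\delta$-hyperbolic for some $\delta$, with Gromov boundary $\partial S$; groups act on $S$ by isometries, and $S\cup\partial S$ carries its usual topology. The limit set $\Lambda_S(G)\subseteq\partial S$ is the intersection of $\partial S$ with the closure of an orbit $Gs$ in $S\cup\partial S$ (independent of $s\in S$). An element $g\in G$ is loxodromic if $\langle g\rangle$ has unbounded orbits and fixes exactly two points of $\partial S$. An action of $G$ on $S$ is of general type if its orbits are unbounded and $G$ contains two loxodromic elements with disjoint fixed point sets in $\partial S$. A group $G$ is faithful weakly hyperbolic if it admits a general type action on a hyperbolic space $S$ such that the induced action on $\Lambda_S(G)$ is faithful; it is lim-free if it admits a general type action on a hyperbolic space $S$ such that the induced action on $\Lambda_S(G)$ is topologically free, i.e. the fixed point set in $\Lambda_S(G)$ of every nontrivial $g\in G$ has empty interior in $\Lambda_S(G)$. A group $G$ is mixed identity free (MIF) if for every $n$ and every nontrivial $w\in G*F_n$ (with $F_n$ free of rank $n$) some homomorphism $G*F_n\to G$ that is the identity on $G$ does not send $w$ to $1$. A group is linear if it embeds in $GL_n(F)$ for some field $F$ and some $n$. Corollary.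 Let $G$ be a faithful weakly hyperbolic group. If $G$ is residually finite, then $G$ is lim-free and MIF. In particular, if $G$ is finitely generated and linear, then $G$ is lim-free and MIF. -/

import Mathlib

open Filter Topology

universe u v w

namespace WeaklyHyperbolic

/-! ### Gromov hyperbolic geodesic metric spaces -/

/-- The Gromov product `⟨x | y⟩_o = (d(x,o) + d(y,o) - d(x,y)) / 2`. -/
noncomputable def gromovProduct {S : Type v} [MetricSpace S] (o x y : S) : ℝ :=
  (dist x o + dist y o - dist x y) / 2

/-- A geodesic metric space: any two points are joined by an isometrically embedded segment. -/
def IsGeodesicSpace (S : Type v) [MetricSpace S] : Prop :=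
  ∀ x y : S, ∃ γ : ℝ → S, γ 0 = x ∧ γ (dist x y) = y ∧
    ∀ s ∈ Set.Icc 0 (dist x y), ∀ t ∈ Set.Icc 0 (dist x y), dist (γ s) (γ t) = |s - t|

/-- The four-point condition with constant `δ`. -/
def IsDeltaHyperbolic (S : Type v) [MetricSpace S] (δ : ℝ) : Prop :=
  ∀ x y z o : S, min (gromovProduct o x z) (gromovProduct o z y) - δ ≤ gromovProduct o x y

/-- A hyperbolic space: a geodesic metric space that is `δ`-hyperbolic for some `δ`. -/
class HyperbolicSpace (S : Type v) [MetricSpace S] : Prop where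
  geodesic : IsGeodesicSpace S
  hyperbolic : ∃ δ : ℝ, IsDeltaHyperbolic S δ

/-! ### The Gromov boundary -/

/-- `⟨x_i | y_j⟩_o → ∞` as `i, j → ∞`, for every base point `o`. -/
def ProductDiverges {S : Type v} [MetricSpace S] (x y : ℕ → S) : Prop :=
  ∀ o : S, Tendsto (fun p : ℕ × ℕ => gromovProduct o (x p.1) (y p.2)) atTop atTop

/-- The sequences of points of `S` that converge at infinity. -/
def SeqAtInfinity (S : Type v) [MetricSpace S] : Type v :=
  {x : ℕ → S // ProductDiverges x x}

theorem gromovProduct_comm {S : Type v} [MetricSpace S] (o x y : S) :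
    gromovProduct o x y = gromovProduct o y x := by
  unfold gromovProduct
  rw [dist_comm x y]
  ring

theorem ProductDiverges.symm {S : Type v} [MetricSpace S] {x y : ℕ → S}
    (h : ProductDiverges x y) : ProductDiverges y x := by
  intro o
  have h1 := h o
  rw [tendsto_atTop] at h1 ⊢
  intro b
  obtain ⟨N, hN⟩ := eventually_atTop.1 (h1 b)
  refine eventually_atTop.2 ⟨N.swap, fun p hp => ?_⟩
  rw [gromovProduct_comm]
  exact hN p.swap ⟨hp.2, hp.1⟩

theorem ProductDiverges.trans {S : Type v} [MetricSpace S] [HyperbolicSpace S] {x y z : ℕ → S}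
    (hxy : ProductDiverges x y) (hyz : ProductDiverges y z) : ProductDiverges x z := by
  obtain ⟨δ, hδ⟩ := HyperbolicSpace.hyperbolic (S := S)
  intro o
  have h1 := hxy o
  have h2 := hyz o
  rw [tendsto_atTop] at h1 h2 ⊢
  intro b
  obtain ⟨N, hN⟩ := eventually_atTop.1 (h1 (b + δ))
  obtain ⟨M, hM⟩ := eventually_atTop.1 (h2 (b + δ))
  refine eventually_atTop.2 ⟨(N.1, M.2), fun p hp => ?_⟩
  have e1 := hN (p.1, max N.2 M.1) ⟨hp.1, le_max_left _ _⟩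
  have e2 := hM (max N.2 M.1, p.2) ⟨le_max_right _ _, hp.2⟩
  have e3 := hδ (x p.1) (z p.2) (y (max N.2 M.1)) o
  have e4 := le_min e1 e2
  simp only at e4
  linarith

/-- Equivalence of sequences converging at infinity. -/
instance seqSetoid (S : Type v) [MetricSpace S] [HyperbolicSpace S] :
    Setoid (SeqAtInfinity S) where
  r x y := ProductDiverges x.1 y.1
  iseqv := ⟨fun x => x.2, fun h => h.symm, fun h h' => h.trans h'⟩

/-- The Gromov boundary `∂S`. -/
def GromovBoundary (S : Type v) [MetricSpace S] [HyperbolicSpace S] : Type v :=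
  Quotient (seqSetoid S)

/-- The sequence `x` converges to the boundary point `a`. -/
def ConvergesTo {S : Type v} [MetricSpace S] [HyperbolicSpace S]
    (x : SeqAtInfinity S) (a : GromovBoundary S) : Prop :=
  Quotient.mk (seqSetoid S) x = a

/-- The bordification `Ŝ = S ∪ ∂S`. -/
inductive Bordification (S : Type v) [MetricSpace S] [HyperbolicSpace S] : Type v
  | pt (x : S) : Bordification S
  | bd (a : GromovBoundary S) : Bordification S

/-- The Gromov product `⟨a | s⟩_o` of a boundary point `a` with a point `s` of `S ∪ ∂S`: the infimum
of `liminf ⟨x_i | s⟩_o` (for `s` in `S`), respectively of `liminf ⟨x_i | y_j⟩_o`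
(for `s` in `∂S`), over all sequences `x → a` (and `y → s`). -/
noncomputable def bdProduct {S : Type v} [MetricSpace S] [HyperbolicSpace S]
    (o : S) (a : GromovBoundary S) : Bordification S → EReal
  | .pt s => ⨅ (x : SeqAtInfinity S) (_ : ConvergesTo x a),
      liminf (fun i : ℕ => ((gromovProduct o (x.1 i) s : ℝ) : EReal)) atTop
  | .bd b => ⨅ (x : SeqAtInfinity S) (_ : ConvergesTo x a)
      (y : SeqAtInfinity S) (_ : ConvergesTo y b),
      liminf (fun p : ℕ × ℕ => ((gromovProduct o (x.1 p.1) (y.1 p.2) : ℝ) : EReal)) atTop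

/-- The basic neighbourhood `U_o(a, r)` of the boundary point `a` in `S ∪ ∂S`. -/
def bdNhd {S : Type v} [MetricSpace S] [HyperbolicSpace S]
    (o : S) (a : GromovBoundary S) (r : ℝ) : Set (Bordification S) :=
  {s | (r : EReal) < bdProduct o a s}

theorem bdNhd_anti {S : Type v} [MetricSpace S] [HyperbolicSpace S]
    (o : S) (a : GromovBoundary S) {r r' : ℝ} (h : r ≤ r') : bdNhd o a r' ⊆ bdNhd o a r :=
  fun _ hs => lt_of_le_of_lt (EReal.coe_le_coe_iff.2 h) hs

/-- The topology of `S ∪ ∂S`: the points of `S` have their metric neighbourhoods, and the sets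
`U_o(a, r)` form a neighbourhood base at the boundary point `a`. -/
instance bordificationTopology (S : Type v) [MetricSpace S] [HyperbolicSpace S] :
    TopologicalSpace (Bordification S) where
  IsOpen U := IsOpen {x : S | Bordification.pt x ∈ U} ∧
    ∀ a : GromovBoundary S, Bordification.bd a ∈ U → ∀ o : S, ∃ r : ℝ, bdNhd o a r ⊆ U
  isOpen_univ := ⟨by simp, fun _ _ _ => ⟨0, Set.subset_univ _⟩⟩
  isOpen_inter := by
    rintro U V ⟨hU, hU'⟩ ⟨hV, hV'⟩
    refine ⟨hU.inter hV, fun a ha o => ?_⟩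
    obtain ⟨r, hr⟩ := hU' a ha.1 o
    obtain ⟨r', hr'⟩ := hV' a ha.2 o
    exact ⟨max r r', Set.subset_inter ((bdNhd_anti o a (le_max_left r r')).trans hr)
      ((bdNhd_anti o a (le_max_right r r')).trans hr')⟩
  isOpen_sUnion := by
    intro C hC
    constructor
    · have h : {x : S | Bordification.pt x ∈ ⋃₀ C}
          = ⋃ U ∈ C, {x : S | Bordification.pt x ∈ U} := by
        ext x
        simp
      rw [h]
      exact isOpen_biUnion fun U hU => (hC U hU).1
    · rintro a ⟨U, hU, ha⟩ o
      obtain ⟨r, hr⟩ := (hC U hU).2 a ha o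
      exact ⟨r, hr.trans (Set.subset_sUnion_of_mem hU)⟩

/-- The topology of `∂S` as a subspace of `S ∪ ∂S`. -/
instance boundaryTopology (S : Type v) [MetricSpace S] [HyperbolicSpace S] :
    TopologicalSpace (GromovBoundary S) :=
  TopologicalSpace.induced Bordification.bd inferInstance

/-! ### Isometric actions -/

section Action

variable {G : Type u} [Group G] {S : Type v} [MetricSpace S] [MulAction G S] [IsIsometricSMul G S]

theorem gromovProduct_smul (g : G) (o x y : S) :
    gromovProduct o (g • x) (g • y) = gromovProduct (g⁻¹ • o) x y := by
  have h : ∀ z : S, dist (g • z) o = dist z (g⁻¹ • o) := fun z => by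
    rw [← dist_smul g z (g⁻¹ • o), smul_inv_smul]
  simp only [gromovProduct, h, dist_smul]

theorem ProductDiverges.smul (g : G) {x y : ℕ → S} (h : ProductDiverges x y) :
    ProductDiverges (fun i => g • x i) (fun i => g • y i) := by
  intro o
  simp only [gromovProduct_smul]
  exact h (g⁻¹ • o)

/-- The induced action on the boundary: `g` maps the class of `(x_i)` to the class of
`(g x_i)`. -/
instance boundaryAction [HyperbolicSpace S] : MulAction G (GromovBoundary S) where
  smul g := Quotient.map (fun x : SeqAtInfinity S => ⟨fun i => g • x.1 i, x.2.smul g⟩)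
    (fun _ _ h => ProductDiverges.smul g h)
  one_smul a := by
    induction a using Quotient.inductionOn with
    | h x => exact congrArg (Quotient.mk _) (Subtype.ext (funext fun i => one_smul G (x.1 i)))
  mul_smul g h a := by
    induction a using Quotient.inductionOn with
    | h x => exact congrArg (Quotient.mk _) (Subtype.ext (funext fun i => mul_smul g h (x.1 i)))

variable (G S)

/-- The limit set `Λ_S(G)`: the boundary points in the closure, in `S ∪ ∂S`, of an orbit `Gs`
(the choice of `s` does not matter). -/
def limitSet [HyperbolicSpace S] : Set (GromovBoundary S) :=
  {a | ∃ s : S, Bordification.bd a ∈ closure (Bordification.pt '' MulAction.orbit G s)}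

variable {G}

/-- A loxodromic element: `⟨g⟩` has unbounded orbits and `g` fixes exactly two boundary
points. -/
def IsLoxodromic [HyperbolicSpace S] (g : G) : Prop :=
  (∀ s : S, ¬ Bornology.IsBounded (Set.range fun n : ℤ => g ^ n • s)) ∧
    (MulAction.fixedBy (GromovBoundary S) g).ncard = 2

variable (G)

/-- An action of general type: the orbits are unbounded and there are two loxodromic elements
with disjoint sets of fixed points on the boundary. -/
def IsGeneralType [HyperbolicSpace S] : Prop :=
  (∀ s : S, ¬ Bornology.IsBounded (MulAction.orbit G s)) ∧
    ∃ g h : G, IsLoxodromic S g ∧ IsLoxodromic S h ∧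
      Disjoint (MulAction.fixedBy (GromovBoundary S) g) (MulAction.fixedBy (GromovBoundary S) h)

/-- The induced action on the limit set is faithful. -/
def FaithfulOnLimitSet [HyperbolicSpace S] : Prop :=
  ∀ g : G, (∀ a ∈ limitSet G S, g • a = a) → g = 1

/-- The induced action on the limit set (with the subspace topology) is topologically free: the
fixed point set of every nontrivial element has empty interior in the limit set. -/
def TopologicallyFreeOnLimitSet [HyperbolicSpace S] : Prop :=
  ∀ g : G, g ≠ 1 →
    interior {a : limitSet G S | g • (a : GromovBoundary S) = (a : GromovBoundary S)} = ∅

end Action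

/-! ### Classes of groups -/

/-- Faithful weakly hyperbolic groups. -/
def IsFaithfulWeaklyHyperbolic (G : Type u) [Group G] : Prop :=
  ∃ (S : Type v) (_ : MetricSpace S) (_ : HyperbolicSpace S)
    (_ : MulAction G S) (_ : IsIsometricSMul G S),
    IsGeneralType G S ∧ FaithfulOnLimitSet G S

/-- Lim-free weakly hyperbolic groups. -/
def IsLimFree (G : Type u) [Group G] : Prop :=
  ∃ (S : Type v) (_ : MetricSpace S) (_ : HyperbolicSpace S)
    (_ : MulAction G S) (_ : IsIsometricSMul G S),
    IsGeneralType G S ∧ TopologicallyFreeOnLimitSet G S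

/-- `G` satisfies the mixed identity `w = 1`, where `w` lies in `G * F_n`: every homomorphism
`G * F_n → G` that is the identity on `G` sends `w` to `1`. -/
def SatisfiesMixedIdentity (G : Type u) [Group G] {n : ℕ}
    (w : Monoid.Coprod G (FreeGroup (Fin n))) : Prop :=
  ∀ φ : Monoid.Coprod G (FreeGroup (Fin n)) →* G,
    (∀ g : G, φ (Monoid.Coprod.inl g) = g) → φ w = 1

/-- Mixed identity free groups. -/
def IsMIF (G : Type u) [Group G] : Prop :=
  ∀ (n : ℕ) (w : Monoid.Coprod G (FreeGroup (Fin n))), SatisfiesMixedIdentity G w → w = 1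

/-- Linear groups: groups that embed in `GL_n(F)` for some field `F` and some `n`. -/
def IsLinearGroup (G : Type u) [Group G] : Prop :=
  ∃ (F : Type w) (_ : Field F) (n : ℕ) (ρ : G →* Matrix.GeneralLinearGroup (Fin n) F),
    Function.Injective ρ

end WeaklyHyperbolic

/-! ### Residual finiteness of finitely generated linear groups. -/

section Malcev

/-! The geometry enters only through one dynamical fact: a general type action is extremely proximal
on its limit set (`isExtremelyProximal_of_isGeneralType`). Given limit points `a` and `b`, some `f`
has `f • o` near `b` and `f⁻¹ • o` near `a`, and such an `f` sends everything away from `a` close to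
`b`. The rest is topological dynamics on a Hausdorff space with at least three points.

Residual finiteness makes a faithful extremely proximal action topologically free. Let `a`, `b` fix
an open set `U` pointwise and let `N` be normal of finite index. Some `f ∈ N` moves the complement
of `U` into `U`, so `f⁻¹ b f` fixes that complement and commutes with `a`. Modulo `N` it equals `b`,
hence `[a, b]` lies in every `N` and is trivial (`commute_of_fix_open`). If `g ≠ 1` fixes `U`, a
conjugate of `g` supported in a set that `g` displaces also fixes `U`, hence commutes with `g`,
which is impossible.

Topological freeness then gives MIF by ping-pong: there are open sets in general position with
respect to the coefficients of a reduced word, and extreme proximality supplies values of the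
variables that play ping-pong on them (`isMIF_of_isTopologicallyFree`). The linear case follows from
Mal'cev's theorem. -/

theorem isJacobsonRing_int : IsJacobsonRing ℤ := by
  refine isJacobsonRing_iff_prime_eq.2 fun P hP => ?_
  by_cases h0 : P = ⊥
  · subst h0
    refine (Submodule.eq_bot_iff _).2 fun x hx => ?_
    by_contra hx0
    -- A nonzero integer is not divisible by a prime larger than its absolute value.
    obtain ⟨p, hlt, hp⟩ := Nat.exists_infinite_primes (x.natAbs + 1)
    have hmax : (Ideal.span {(p : ℤ)}).IsMaximal :=
      PrincipalIdealRing.isMaximal_of_irreducible (Nat.prime_iff_prime_int.1 hp).irreducible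
    have hmem := (Submodule.mem_sInf.1 hx) _ ⟨bot_le, hmax⟩
    have hdvd := Ideal.mem_span_singleton.1 hmem
    have := Nat.le_of_dvd (Int.natAbs_pos.2 hx0) (Int.natCast_dvd.1 hdvd)
    omega
  · have := hP.isMaximal h0
    exact Ideal.jacobson_eq_self_of_isMaximal

/-- In characteristic zero, integrality of `K` over `ℤ` would make `ℤ` a field. Hence the
characteristic `p` is positive, and `K` is a finitely generated abelian group killed by `p`. -/
theorem finite_of_field_of_module_finite_int (K : Type*) [Field K] [Module.Finite ℤ K] :
    Finite K := by
  have hint : Algebra.IsIntegral ℤ K := inferInstance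
  by_cases hinj : Function.Injective (algebraMap ℤ K)
  · exact absurd (isField_of_isIntegral_of_isField hinj (Field.toIsField K)) Int.not_isField
  · obtain ⟨p, hp⟩ := CharP.exists K
    have hp0 : p ≠ 0 := by
      rintro rfl
      have : CharZero K := CharP.charP_to_charZero K
      exact hinj (by simpa using Int.cast_injective (α := K))
    refine Module.finite_of_fg_torsion K fun x => ⟨⟨(p : ℤ), by simpa using hp0⟩, ?_⟩
    simp [Submonoid.smul_def]

/-- A finitely generated domain has enough finite residue fields. -/
theorem exists_maximal_notMem_finite_quotient {A : Type*} [CommRing A] [IsDomain A]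
    [Algebra.FiniteType ℤ A] {a : A} (ha : a ≠ 0) :
    ∃ m : Ideal A, m.IsMaximal ∧ a ∉ m ∧ Finite (A ⧸ m) := by
  have := isJacobsonRing_int
  have hJ : IsJacobsonRing A := isJacobsonRing_of_finiteType (A := ℤ)
  have h0 : (⊥ : Ideal A).jacobson = ⊥ := hJ.out Ideal.isRadical_bot
  have : a ∉ (⊥ : Ideal A).jacobson := by rwa [h0]
  rw [Ideal.jacobson, Submodule.mem_sInf] at this
  push Not at this
  obtain ⟨m, ⟨-, hm⟩, ham⟩ := this
  refine ⟨m, hm, ham, ?_⟩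
  let _ := Ideal.Quotient.field m
  have : Algebra.FiniteType ℤ (A ⧸ m) :=
    Algebra.FiniteType.of_surjective (Ideal.Quotient.mkₐ ℤ m) Ideal.Quotient.mk_surjective
  -- Zariski's lemma over a Jacobson base: the residue field is a finite `ℤ`-module.
  have := finite_of_finite_type_of_isJacobsonRing ℤ (A ⧸ m)
  exact finite_of_field_of_module_finite_int (A ⧸ m)

/-- Reduction modulo a maximal ideal that misses a nonzero entry of `Φ g - 1` keeps `g` nontrivial,
and matrices over the finite residue field have a finite unit group. -/
theorem residuallyFinite_of_injective_matrix {G : Type*} [Group G] {A : Type*} [CommRing A]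
    [IsDomain A] [Algebra.FiniteType ℤ A] {n : ℕ} (Φ : G →* Matrix (Fin n) (Fin n) A)
    (hΦ : Function.Injective Φ) : Group.ResiduallyFinite G := by
  rw [Group.residuallyFinite_iff_exists_finiteIndex]
  intro g hg
  have h1 : Φ g ≠ 1 := fun h => hg (hΦ (by rw [h, map_one]))
  obtain ⟨i, j, hij⟩ : ∃ i j, Φ g i j ≠ (1 : Matrix (Fin n) (Fin n) A) i j := by
    by_contra! h
    exact h1 (Matrix.ext h)
  obtain ⟨m, hm, ham, hfin⟩ := exists_maximal_notMem_finite_quotient (sub_ne_zero.2 hij)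
  let Ψ : G →* Matrix (Fin n) (Fin n) (A ⧸ m) :=
    ((Ideal.Quotient.mk m).mapMatrix : Matrix (Fin n) (Fin n) A →+* _).toMonoidHom.comp Φ
  refine ⟨Ψ.toHomUnits.ker, inferInstance, fun hmem => ham ?_⟩
  have h2 : Ψ g = 1 := congrArg Units.val (MonoidHom.mem_ker.1 hmem)
  have h3 := congrFun (congrFun h2 i) j
  rw [← Ideal.Quotient.eq_zero_iff_mem, map_sub, sub_eq_zero]
  have h4 : Ψ g i j = Ideal.Quotient.mk m (Φ g i j) := rfl
  rw [← h4, h3]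
  simp [Matrix.one_apply, apply_ite]

/-- Mal'cev's theorem: finitely generated linear groups are residually finite. -/
theorem residuallyFinite_of_fg_of_linear {G : Type*} [Group G] [Group.FG G] {F : Type*} [Field F]
    {n : ℕ} (ρ : G →* Matrix.GeneralLinearGroup (Fin n) F) (hρ : Function.Injective ρ) :
    Group.ResiduallyFinite G := by
  obtain ⟨S, hS⟩ := Group.fg_def.1 ‹Group.FG G›
  -- With the entries of inverses of generators included, the ring generated by `T` contains the
  -- entries of all of `ρ(G)`.
  let T : Set F := ⋃ g ∈ S, ⋃ i, ⋃ j,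
    {(ρ g : Matrix (Fin n) (Fin n) F) i j, (ρ g⁻¹ : Matrix (Fin n) (Fin n) F) i j}
  have hT : T.Finite := S.finite_toSet.biUnion fun g _ =>
    Set.finite_iUnion fun i => Set.finite_iUnion fun j => Set.toFinite _
  have hsub : ∀ g ∈ S, ∀ i j, (ρ g : Matrix (Fin n) (Fin n) F) i j ∈ T ∧
      (ρ g⁻¹ : Matrix (Fin n) (Fin n) F) i j ∈ T := by
    intro g hg i j
    simp only [T, Set.mem_iUnion]
    exact ⟨⟨g, hg, i, j, by simp⟩, ⟨g, hg, i, j, by simp⟩⟩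
  let A := Algebra.adjoin ℤ T
  have hfin : Algebra.FiniteType ℤ A :=
    (Subalgebra.fg_iff_finiteType _).1 ⟨hT.toFinset, by simp [A]⟩
  have hmem : ∀ g : G, ∀ i j, (ρ g : Matrix (Fin n) (Fin n) F) i j ∈ A := by
    intro g
    have hg : g ∈ Subgroup.closure (S : Set G) := hS ▸ Subgroup.mem_top g
    have hmul : ∀ x y : G, (∀ i j, (ρ x : Matrix (Fin n) (Fin n) F) i j ∈ A) →
        (∀ i j, (ρ y : Matrix (Fin n) (Fin n) F) i j ∈ A) →
        ∀ i j, (ρ (x * y) : Matrix (Fin n) (Fin n) F) i j ∈ A := by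
      intro x y hx hy i j
      rw [map_mul, Units.val_mul, Matrix.mul_apply]
      exact Subalgebra.sum_mem _ fun k _ => A.mul_mem (hx i k) (hy k j)
    induction hg using Subgroup.closure_induction'' with
    | mem x hx => exact fun i j => Algebra.subset_adjoin (hsub x hx i j).1
    | inv_mem x hx => exact fun i j => Algebra.subset_adjoin (hsub x hx i j).2
    | one =>
      intro i j
      rw [map_one, Units.val_one, Matrix.one_apply]
      split_ifs
      exacts [A.one_mem, A.zero_mem]
    | mul x y _ _ hx hy => exact hmul x y hx hy
  have hext : ∀ X Y : Matrix (Fin n) (Fin n) A,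
      X.map (algebraMap A F) = Y.map (algebraMap A F) → X = Y := fun X Y h =>
    Matrix.map_injective (FaithfulSMul.algebraMap_injective A F) h
  let φ : G → Matrix (Fin n) (Fin n) A := fun g => Matrix.of fun i j => ⟨_, hmem g i j⟩
  have hφ : ∀ g, (φ g).map (algebraMap A F) = (ρ g : Matrix (Fin n) (Fin n) F) := fun g => rfl
  let Φ : G →* Matrix (Fin n) (Fin n) A :=
    { toFun := φ
      map_one' := hext _ _ (by rw [hφ, map_one, Units.val_one, Matrix.map_one _ (map_zero _) (map_one _)])
      map_mul' := fun x y => hext _ _ (by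
        rw [Matrix.map_mul, hφ, hφ, hφ, map_mul, Units.val_mul]) }
  refine residuallyFinite_of_injective_matrix Φ fun x y hxy => hρ (Units.ext ?_)
  rw [← hφ x, ← hφ y]
  exact congrArg (fun X : Matrix (Fin n) (Fin n) A => X.map (algebraMap A F)) hxy

end Malcev

/-! ### Extremely proximal actions -/

section Dynamics

/-- The complement of every nonempty open set can be moved into every nonempty open set. -/
def IsExtremelyProximal (G X : Type*) [Group G] [MulAction G X] [TopologicalSpace X] : Prop :=
  ∀ U V : Set X, IsOpen U → IsOpen V → U.Nonempty → V.Nonempty → ∃ f : G, ∀ x ∉ U, f • x ∈ V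

/-- Fixed point sets of nontrivial elements have empty interior. -/
def IsTopologicallyFree (G X : Type*) [Group G] [MulAction G X] [TopologicalSpace X] : Prop :=
  ∀ g : G, g ≠ 1 → interior {x : X | g • x = x} = ∅

variable {G X : Type*} [Group G] [MulAction G X] [TopologicalSpace X]

/-- If `{p}` were open, one element would send every point other than `p` to `p`, contradicting
injectivity. -/
theorem IsExtremelyProximal.not_isOpen_singleton (hE : IsExtremelyProximal G X)
    (h3 : ∀ p : X, ∃ x y, x ≠ p ∧ y ≠ p ∧ x ≠ y) (p : X) : ¬ IsOpen ({p} : Set X) := by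
  intro hp
  obtain ⟨x, y, hx, hy, hxy⟩ := h3 p
  obtain ⟨f, hf⟩ := hE _ _ hp hp ⟨p, rfl⟩ ⟨p, rfl⟩
  exact hxy (smul_left_cancel f ((hf x hx).trans (hf y hy).symm))

/-- Inside `U` take disjoint open sets and let `f` move the complement of the first into the second.
Every positive power of `f` then moves the complement of `U` into `U`, and some positive power lies
in `N`. -/
theorem IsExtremelyProximal.exists_mem_of_finiteIndex [T2Space X] (hE : IsExtremelyProximal G X)
    (h3 : ∀ p : X, ∃ x y, x ≠ p ∧ y ≠ p ∧ x ≠ y) (N : Subgroup G) [N.FiniteIndex]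
    {U : Set X} (hU : IsOpen U) (hU' : U.Nonempty) : ∃ f ∈ N, ∀ x ∉ U, f • x ∈ U := by
  obtain ⟨p, hp⟩ := hU'
  obtain ⟨q, hq, hqp⟩ : ∃ q ∈ U, q ≠ p := by
    by_contra! h
    refine hE.not_isOpen_singleton h3 p ?_
    rwa [← Set.eq_singleton_iff_unique_mem.2 ⟨hp, h⟩]
  obtain ⟨V, W, hV, hW, hpV, hqW, hVW⟩ := t2_separation hqp.symm
  obtain ⟨f, hf⟩ := hE (U ∩ V) (U ∩ W) (hU.inter hV) (hU.inter hW) ⟨p, hp, hpV⟩ ⟨q, hq, hqW⟩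
  have hpow : ∀ n : ℕ, ∀ x ∉ U, f ^ (n + 1) • x ∈ U ∩ W := by
    intro n x hx
    induction n with
    | zero => simpa using hf x fun h => hx h.1
    | succ n ih =>
      rw [pow_succ', mul_smul]
      exact hf _ fun h => Set.disjoint_left.1 hVW h.2 ih.2
  obtain ⟨n, hn, -, hfn⟩ := Subgroup.exists_pow_mem_of_index_ne_zero (H := N)
    Subgroup.FiniteIndex.index_ne_zero f
  obtain ⟨k, rfl⟩ := Nat.exists_eq_succ_of_ne_zero hn.ne'
  exact ⟨_, hfn, fun x hx => (hpow k x hx).1⟩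

/-- Elements with disjoint supports commute: if `c` moves `x`, it also moves `c • x`, so `d` fixes
both points. -/
theorem commute_of_forall_smul_eq_or {G X : Type*} [Group G] [MulAction G X] [FaithfulSMul G X] {a b : G}
    (h : ∀ x : X, a • x = x ∨ b • x = x) : Commute a b := by
  have key : ∀ {c d : G}, (∀ x : X, c • x = x ∨ d • x = x) → ∀ x : X, c • x ≠ x →
      (c * d) • x = (d * c) • x := by
    intro c d h x hx
    have h1 : d • x = x := (h x).resolve_left hx
    have h2 : d • c • x = c • x := (h (c • x)).resolve_left fun h => hx (smul_left_cancel c h)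
    rw [mul_smul, mul_smul, h1, h2]
  refine eq_of_smul_eq_smul (α := X) fun x => ?_
  by_cases hx : a • x = x
  · by_cases hx' : b • x = x
    · rw [mul_smul, mul_smul, hx, hx', hx]
    · exact (key (fun x => (h x).symm) x hx').symm
  · exact key h x hx

/-- This is where residual finiteness acts: conjugating `b` by an element of `N` makes its support
disjoint from that of `a` without changing its class modulo `N`. -/
theorem commute_of_fix_open [T2Space X] [FaithfulSMul G X] [Group.ResiduallyFinite G]
    (hE : IsExtremelyProximal G X) (h3 : ∀ p : X, ∃ x y, x ≠ p ∧ y ≠ p ∧ x ≠ y)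
    {U : Set X} (hU : IsOpen U) (hU' : U.Nonempty) {a b : G} (ha : ∀ x ∈ U, a • x = x)
    (hb : ∀ x ∈ U, b • x = x) : Commute a b := by
  rw [← commutatorElement_eq_one_iff_commute]
  refine Group.eq_one_iff_forall_finiteIndexNormalSubroup _ fun N => ?_
  obtain ⟨f, hfN, hf⟩ := hE.exists_mem_of_finiteIndex h3 N.toSubgroup hU hU'
  have hcomm : Commute a (f⁻¹ * b * f) := commute_of_forall_smul_eq_or (X := X) fun x => by
    by_cases hx : x ∈ U
    · exact Or.inl (ha x hx)
    · right
      rw [mul_smul, mul_smul, hb _ (hf x hx), inv_smul_smul]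
  have hfN' : (QuotientGroup.mk' N.toSubgroup) f = 1 := (QuotientGroup.eq_one_iff f).2 hfN
  have hq := congrArg (QuotientGroup.mk' N.toSubgroup) (commutatorElement_eq_one_iff_commute.2 hcomm)
  rw [map_commutatorElement, map_mul, map_mul, map_inv, hfN', inv_one, one_mul, mul_one,
    ← map_commutatorElement, map_one] at hq
  exact (QuotientGroup.eq_one_iff _).1 hq

/-- A faithful extremely proximal action of a residually finite group is topologically free. -/
theorem IsExtremelyProximal.isTopologicallyFree [T2Space X] [FaithfulSMul G X]
    [ContinuousConstSMul G X] [Group.ResiduallyFinite G]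
    (hE : IsExtremelyProximal G X) (h3 : ∀ p : X, ∃ x y, x ≠ p ∧ y ≠ p ∧ x ≠ y) :
    IsTopologicallyFree G X := by
  intro g hg
  by_contra hne
  set U := interior {x : X | g • x = x} with hUdef
  have hU : IsOpen U := isOpen_interior
  have hU' : U.Nonempty := Set.nonempty_iff_ne_empty.2 hne
  have hgU : ∀ x ∈ U, g • x = x := fun x hx =>
    (interior_subset hx : x ∈ {x : X | g • x = x})
  have hmove : ∀ k : G, k ≠ 1 → ∃ x : X, k • x ≠ x := by
    intro k hk
    by_contra! h
    exact hk (eq_of_smul_eq_smul (α := X) fun x => by rw [h, one_smul])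
  obtain ⟨x, hx⟩ := hmove g hg
  obtain ⟨V, W, hV, hW, hxV, hxW, hVW⟩ := t2_separation hx
  -- This open set is disjoint from its image under `g`, hence also from `U`, where `g` is trivial.
  have hV1 : IsOpen (W ∩ (g • ·) ⁻¹' V) := hW.inter (hV.preimage (continuous_const_smul g))
  obtain ⟨f, hf⟩ := hE U _ hU hV1 hU' ⟨x, hxW, hxV⟩
  set V1 := W ∩ (g • ·) ⁻¹' V with hV1def
  have hgV1 : ∀ y ∈ V1, g • y ∉ V1 := fun y hy h => Set.disjoint_left.1 hVW hy.2 h.1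
  have hk : ∀ y ∉ V1, (f * g * f⁻¹) • y = y := by
    intro y hy
    have : f⁻¹ • y ∈ U := by
      by_contra h
      exact hy (by simpa using hf _ h)
    rw [mul_smul, mul_smul, hgU _ this, smul_inv_smul]
  have hkU : ∀ y ∈ U, (f * g * f⁻¹) • y = y := fun y hy => hk y fun hy1 =>
    hgV1 y hy1 (by rwa [hgU y hy])
  have hcomm : Commute g (f * g * f⁻¹) := commute_of_fix_open hE h3 hU hU' hgU hkU
  obtain ⟨y, hy⟩ := hmove (f * g * f⁻¹) (by simpa using hg)
  have hyV : y ∈ V1 := by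
    by_contra h
    exact hy (hk y h)
  -- The conjugate moves `y` but fixes `g • y`, since `g • y` has left `V1`; commuting with `g`
  -- forbids this.
  have h1 := hk _ (hgV1 y hyV)
  rw [← mul_smul, ← hcomm.eq, mul_smul] at h1
  exact hy (smul_left_cancel g h1)

/-! ### Points in general position -/

theorem exists_notMem_of_finite_of_interior_eq_empty [Nonempty X] {ι : Type*} (s : Set ι)
    (hs : s.Finite) (C : ι → Set X) (hC : ∀ i ∈ s, IsClosed (C i))
    (hC' : ∀ i ∈ s, interior (C i) = ∅) : ∃ x, ∀ i ∈ s, x ∉ C i := by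
  have key : IsClosed (⋃ i ∈ s, C i) ∧ interior (⋃ i ∈ s, C i) = ∅ := by
    induction s, hs using Set.Finite.induction_on with
    | empty => simp
    | @insert a t _ _ ih =>
      obtain ⟨h1, h2⟩ := ih (fun i hi => hC i (Or.inr hi)) (fun i hi => hC' i (Or.inr hi))
      rw [Set.biUnion_insert]
      have ha := hC a (Or.inl rfl)
      exact ⟨ha.union h1, by
        rw [interior_union_isClosed_of_interior_empty ha h2]; exact hC' a (Or.inl rfl)⟩
  by_contra! h
  have : (⋃ i ∈ s, C i) = Set.univ := Set.eq_univ_of_forall fun x => by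
    obtain ⟨i, hi, hx⟩ := h x
    exact Set.mem_biUnion hi hx
  rw [this, interior_univ] at key
  exact Set.univ_nonempty.ne_empty key.2

/-- Points are chosen one at a time. The next one must avoid the fixed sets of the nontrivial
elements of `A` and the translates of earlier points by `A` and `A⁻¹`: finitely many closed sets
with empty interior, hence not all of `X`. -/
theorem exists_points_in_general_position [T2Space X] [ContinuousConstSMul G X] [Nonempty X]
    (hF : IsTopologicallyFree G X) (hiso : ∀ p : X, ¬ IsOpen ({p} : Set X)) {A : Set G}
    (hA : A.Finite) (m : ℕ) :
    ∃ p : ℕ → X, ∀ i < m, ∀ j < m, ∀ g ∈ A, (g ≠ 1 ∨ i ≠ j) → g • p i ≠ p j := by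
  induction m with
  | zero => exact ⟨fun _ => Classical.arbitrary X, by simp⟩
  | succ m ih =>
    obtain ⟨p, hp⟩ := ih
    have hsing : ∀ q : X, IsClosed ({q} : Set X) ∧ interior ({q} : Set X) = ∅ := fun q =>
      ⟨isClosed_singleton, Set.eq_empty_of_forall_notMem fun y hy => by
        have hyq : y ∈ ({q} : Set X) := interior_subset hy
        obtain rfl : y = q := hyq
        refine hiso y ?_
        rw [← interior_eq_iff_isOpen]
        exact interior_subset.antisymm (Set.singleton_subset_iff.2 hy)⟩
    obtain ⟨x, hx⟩ : ∃ x : X, (∀ g ∈ A, g ≠ 1 → g • x ≠ x) ∧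
        ∀ g ∈ A, ∀ i < m, x ≠ g • p i ∧ x ≠ g⁻¹ • p i := by
      suffices h : ∃ x : X, ∀ s ∈ {s : Set X | ∃ g ∈ A, g ≠ 1 ∧ s = {x : X | g • x = x}} ∪
          {s | ∃ g ∈ A, ∃ i < m, s = {g • p i} ∨ s = {g⁻¹ • p i}}, x ∉ id s by
        obtain ⟨x, hx⟩ := h
        exact ⟨x, fun g hg hg1 h => hx _ (Or.inl ⟨g, hg, hg1, rfl⟩) h, fun g hg i hi =>
          ⟨fun h => hx _ (Or.inr ⟨g, hg, i, hi, Or.inl rfl⟩) h,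
            fun h => hx _ (Or.inr ⟨g, hg, i, hi, Or.inr rfl⟩) h⟩⟩
      refine exists_notMem_of_finite_of_interior_eq_empty _ ?_ id ?_ ?_
      · refine Set.Finite.union ((hA.image fun g => {x : X | g • x = x}).subset ?_)
          ((((hA.prod (Set.finite_lt_nat m)).image fun q => ({q.1 • p q.2} : Set X)).union
            ((hA.prod (Set.finite_lt_nat m)).image fun q => ({q.1⁻¹ • p q.2} : Set X))).subset ?_)
        · rintro _ ⟨g, hg, -, rfl⟩
          exact ⟨g, hg, rfl⟩
        · rintro _ ⟨g, hg, i, hi, rfl | rfl⟩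
          · exact Or.inl ⟨(g, i), ⟨hg, hi⟩, rfl⟩
          · exact Or.inr ⟨(g, i), ⟨hg, hi⟩, rfl⟩
      · rintro _ (⟨g, hg, -, rfl⟩ | ⟨g, hg, i, hi, rfl | rfl⟩)
        · exact isClosed_eq (continuous_const_smul g) continuous_id
        · exact (hsing _).1
        · exact (hsing _).1
      · rintro _ (⟨g, hg, hg1, rfl⟩ | ⟨g, hg, i, hi, rfl | rfl⟩)
        · exact hF g hg1
        · exact (hsing _).2
        · exact (hsing _).2
    refine ⟨Function.update p m x, fun i hi j hj g hg hij => ?_⟩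
    rcases (Nat.lt_succ_iff_lt_or_eq.1 hi) with hi | rfl <;>
      rcases (Nat.lt_succ_iff_lt_or_eq.1 hj) with hj | rfl
    · rw [Function.update_of_ne hi.ne, Function.update_of_ne hj.ne]
      exact hp i hi j hj g hg hij
    · rw [Function.update_of_ne hi.ne, Function.update_self]
      exact ((hx.2 g hg i hi).1).symm
    · rw [Function.update_of_ne hj.ne, Function.update_self]
      exact fun h => (hx.2 g hg j hj).2 (by rw [← h, inv_smul_smul])
    · rw [Function.update_self]
      exact hx.1 g hg (hij.resolve_right fun h => h rfl)

/-- Each required inequality between points persists on neighbourhoods by continuity and the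
Hausdorff property; finitely many neighbourhoods are intersected around each point. -/
theorem exists_open_in_general_position [T2Space X] [ContinuousConstSMul G X] [Nonempty X]
    (hF : IsTopologicallyFree G X) (hiso : ∀ p : X, ¬ IsOpen ({p} : Set X)) {A : Set G}
    (hA : A.Finite) (ι : Type*) [Finite ι] :
    ∃ U : ι → Set X, (∀ i, IsOpen (U i)) ∧ (∀ i, (U i).Nonempty) ∧
      ∀ i j, ∀ g ∈ A, (g ≠ 1 ∨ i ≠ j) → ∀ x ∈ U i, g • x ∉ U j := by
  obtain ⟨m, ⟨e⟩⟩ := Finite.exists_equiv_fin ι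
  obtain ⟨p, hp⟩ := exists_points_in_general_position hF hiso hA m
  have hsep : ∀ (i j : ι) (g : A), ∃ V W : Set X, IsOpen V ∧ IsOpen W ∧ p (e i) ∈ V ∧
      p (e j) ∈ W ∧ (((g : G) ≠ 1 ∨ i ≠ j) → ∀ x ∈ V, (g : G) • x ∉ W) := by
    intro i j g
    by_cases h : (g : G) ≠ 1 ∨ i ≠ j
    · obtain ⟨V, W, hV, hW, hpV, hpW, hVW⟩ := t2_separation
        (hp (e i) (e i).2 (e j) (e j).2 g g.2
          (h.imp_right fun h h' => h (e.injective (Fin.ext h'))))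
      exact ⟨((g : G) • ·) ⁻¹' V, W, hV.preimage (continuous_const_smul _), hW, hpV, hpW,
        fun _ x hx h => Set.disjoint_left.1 hVW hx h⟩
    · exact ⟨Set.univ, Set.univ, isOpen_univ, isOpen_univ, trivial, trivial,
        fun h' => absurd h' h⟩
  choose V W hV hW hpV hpW hVW using hsep
  have : Finite A := hA
  refine ⟨fun i => ⋂ (j) (g), V i j g ∩ W j i g, fun i => ?_, fun i => ⟨p (e i), ?_⟩, ?_⟩
  · exact isOpen_iInter_of_finite fun j => isOpen_iInter_of_finite fun g =>
      (hV i j g).inter (hW j i g)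
  · simp only [Set.mem_iInter]
    exact fun j g => ⟨hpV i j g, hpW j i g⟩
  · intro i j g hg hij x hx hx'
    simp only [Set.mem_iInter] at hx hx'
    exact hVW i j ⟨g, hg⟩ hij x (hx j ⟨g, hg⟩).1 (hx' i ⟨g, hg⟩).2

end Dynamics

/-! ### Reduced words in `G * F_n` -/

section Words

variable {G : Type*} [Group G] {α : Type*}

/-- The letter `xᵢ` or `xᵢ⁻¹` of the free group. -/
def freeLetter (a : α × Bool) : FreeGroup α :=
  cond a.2 (FreeGroup.of a.1) (FreeGroup.of a.1)⁻¹

/-- The product `a₁ g₁ a₂ g₂ ⋯ aₖ gₖ` in `G * F`. -/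
def wordVal : List ((α × Bool) × G) → Monoid.Coprod G (FreeGroup α)
  | [] => 1
  | (a, g) :: L => Monoid.Coprod.inr (freeLetter a) * Monoid.Coprod.inl g * wordVal L

/-- No letter is followed by its inverse with a trivial coefficient in between. -/
def IsReducedWord : List ((α × Bool) × G) → Prop
  | [] => True
  | (a, g) :: L => IsReducedWord L ∧ (g = 1 → L.head?.map Prod.fst ≠ some (a.1, !a.2))

theorem freeLetter_mul_freeLetter_not (a : α × Bool) :
    freeLetter a * freeLetter (a.1, !a.2) = 1 := by
  rcases a with ⟨i, _ | _⟩ <;> simp [freeLetter]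

/-- A forbidden pair of letters cancels, and the coefficient after the second letter is absorbed to
the left. -/
theorem exists_shorter_of_not_isReducedWord (L : List ((α × Bool) × G)) (hL : ¬ IsReducedWord L) :
    ∃ (g : G) (L' : List ((α × Bool) × G)), L'.length < L.length ∧
      wordVal L = Monoid.Coprod.inl g * wordVal L' := by
  induction L with
  | nil => exact absurd trivial hL
  | cons c L ih =>
    obtain ⟨a, g⟩ := c
    by_cases h : IsReducedWord L
    · simp only [IsReducedWord, h, true_and, not_forall, not_not] at hL
      obtain ⟨rfl, hL⟩ := hL
      cases L with
      | nil => simp at hL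
      | cons d L =>
        obtain ⟨b, k⟩ := d
        simp only [List.head?_cons, Option.map_some, Option.some.injEq] at hL
        subst hL
        refine ⟨k, L, by simp, ?_⟩
        simp only [wordVal, map_one, mul_one]
        rw [← mul_assoc, ← mul_assoc, ← map_mul, freeLetter_mul_freeLetter_not, map_one, one_mul]
    · obtain ⟨k, L', hlen, hval⟩ := ih h
      refine ⟨1, (a, g * k) :: L', by simpa using hlen, ?_⟩
      simp only [wordVal, hval, map_mul, map_one, one_mul, mul_assoc]

theorem exists_word (w : Monoid.Coprod G (FreeGroup α)) :
    ∃ (g : G) (L : List ((α × Bool) × G)), w = Monoid.Coprod.inl g * wordVal L := by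
  induction w using Monoid.Coprod.induction_on' with
  | one => exact ⟨1, [], by simp [wordVal]⟩
  | inl_mul k w ih =>
    obtain ⟨g, L, rfl⟩ := ih
    exact ⟨k * g, L, by rw [map_mul, mul_assoc]⟩
  | inr_mul x w ih =>
    have hletter : ∀ (a : α × Bool) (w : Monoid.Coprod G (FreeGroup α)),
        (∃ (g : G) (L : List ((α × Bool) × G)), w = Monoid.Coprod.inl g * wordVal L) →
        ∃ (g : G) (L : List ((α × Bool) × G)),
          Monoid.Coprod.inr (freeLetter a) * w = Monoid.Coprod.inl g * wordVal L := by
      rintro a _ ⟨g, L, rfl⟩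
      exact ⟨1, (a, g) :: L, by simp [wordVal, mul_assoc]⟩
    induction x using FreeGroup.induction_on generalizing w with
    | C1 => simpa using ih
    | of i => exact hletter (i, true) w ih
    | inv_of i _ => exact hletter (i, false) w ih
    | mul x y hx hy =>
      rw [map_mul, mul_assoc]
      exact hx _ (hy _ ih)

theorem exists_reduced_word (w : Monoid.Coprod G (FreeGroup α)) :
    ∃ (g : G) (L : List ((α × Bool) × G)), IsReducedWord L ∧
      w = Monoid.Coprod.inl g * wordVal L := by
  obtain ⟨g, L, rfl⟩ := exists_word w
  induction hn : L.length using Nat.strong_induction_on generalizing g L with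
  | _ n ih =>
    by_cases h : IsReducedWord L
    · exact ⟨g, L, h, rfl⟩
    · obtain ⟨k, L', hlen, hval⟩ := exists_shorter_of_not_isReducedWord L h
      obtain ⟨g', L'', h1, h2⟩ := ih _ (hn ▸ hlen) (g * k) L' rfl
      exact ⟨g', L'', h1, by rw [← h2, hval, map_mul, mul_assoc]⟩

end Words

/-! ### Mixed identities -/

section MixedIdentity

variable {G : Type*} [Group G] {X : Type*} [MulAction G X]

/-- The ping-pong argument for reduced words in `G * F`. -/
theorem wordVal_smul_mem {α : Type*} {A : Set G} {U : Option (α × Bool) → Set X}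
    (hU : ∀ i j, ∀ g ∈ A, (g ≠ 1 ∨ i ≠ j) → ∀ x ∈ U i, g • x ∉ U j)
    (φ : Monoid.Coprod G (FreeGroup α) →* G) (hφ : ∀ g : G, φ (Monoid.Coprod.inl g) = g)
    (ht : ∀ (a : α × Bool), ∀ x ∉ U (some (a.1, !a.2)),
      φ (Monoid.Coprod.inr (freeLetter a)) • x ∈ U (some a))
    {x : X} (hx : x ∈ U none) (L : List ((α × Bool) × G)) (hL : IsReducedWord L)
    (hLA : ∀ c ∈ L, c.2 ∈ A) : φ (wordVal L) • x ∈ U (L.head?.map Prod.fst) := by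
  induction L with
  | nil => simpa [wordVal] using hx
  | cons c L ih =>
    obtain ⟨a, g⟩ := c
    have ih := ih hL.1 fun c hc => hLA c (List.mem_cons_of_mem _ hc)
    rw [wordVal, map_mul, map_mul, hφ, mul_smul, mul_smul]
    refine ht a _ (hU _ _ g (hLA _ List.mem_cons_self) ?_ _ ih)
    by_cases hg : g = 1
    · exact Or.inr (hL.2 hg)
    · exact Or.inl hg

theorem isMIF_of_isTopologicallyFree [TopologicalSpace X] [T2Space X] [ContinuousConstSMul G X]
    [Nonempty X] (hE : IsExtremelyProximal G X) (h3 : ∀ p : X, ∃ x y, x ≠ p ∧ y ≠ p ∧ x ≠ y)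
    (hF : IsTopologicallyFree G X) : WeaklyHyperbolic.IsMIF G := by
  intro n w hw
  obtain ⟨g, L, hL, rfl⟩ := exists_reduced_word w
  cases L with
  | nil =>
    have h := hw (Monoid.Coprod.lift (MonoidHom.id G) 1) fun g => by simp
    have hg : g = 1 := by simpa [wordVal] using h
    simp [hg, wordVal]
  | cons c L =>
    exfalso
    have hA : ({g} ∪ {k | k ∈ (c :: L).map Prod.snd} : Set G).Finite :=
      (Set.finite_singleton g).union (List.finite_toSet _)
    -- One set for each signed letter, and `U none` for the starting point of the ping-pong.
    obtain ⟨U, hUo, hUn, hU⟩ := exists_open_in_general_position hF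
      (hE.not_isOpen_singleton h3) hA (Option (Fin n × Bool))
    choose t ht using fun i : Fin n => hE (U (some (i, false))) (U (some (i, true)))
      (hUo _) (hUo _) (hUn _) (hUn _)
    let φ : Monoid.Coprod G (FreeGroup (Fin n)) →* G :=
      Monoid.Coprod.lift (MonoidHom.id G) (FreeGroup.lift t)
    have hφ : ∀ g : G, φ (Monoid.Coprod.inl g) = g := fun g => by simp [φ]
    have ht' : ∀ (a : Fin n × Bool), ∀ x ∉ U (some (a.1, !a.2)),
        φ (Monoid.Coprod.inr (freeLetter a)) • x ∈ U (some a) := by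
      rintro ⟨i, _ | _⟩ x hx
      · have : φ (Monoid.Coprod.inr (freeLetter (i, false))) = (t i)⁻¹ := by simp [φ, freeLetter]
        rw [this]
        by_contra h
        exact hx (by simpa using ht i _ h)
      · have : φ (Monoid.Coprod.inr (freeLetter (i, true))) = t i := by simp [φ, freeLetter]
        rw [this]
        exact ht i x hx
    obtain ⟨x, hx⟩ := hUn none
    have h1 := wordVal_smul_mem hU φ hφ ht' hx (c :: L) hL fun d hd =>
      Or.inr (List.mem_map_of_mem hd)
    -- The nonempty word ends in the set of its first letter, and `g` carries that set off `U none`.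
    -- A trivial value of the word would leave `x` in `U none`.
    have h2 := hU _ none g (Or.inl rfl) (Or.inr (by simp)) _ h1
    have h3 := hw φ hφ
    rw [map_mul, hφ] at h3
    rw [← mul_smul, h3, one_smul] at h2
    exact h2 hx

end MixedIdentity

namespace WeaklyHyperbolic

/-! ### Coarse lower bounds for Gromov products on the bordification -/

section Products

variable {S : Type v} [MetricSpace S]

theorem IsDeltaHyperbolic.nonneg {δ : ℝ} (hδ : IsDeltaHyperbolic S δ) (o : S) : 0 ≤ δ := by
  have h := hδ o o o o
  simp only [gromovProduct, dist_self] at h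
  norm_num at h
  exact h

theorem gromovProduct_le_dist_left (o x y : S) : gromovProduct o x y ≤ dist x o := by
  unfold gromovProduct
  linarith [dist_triangle y x o, dist_comm x y]

theorem gromovProduct_le_dist_right (o x y : S) : gromovProduct o x y ≤ dist y o := by
  rw [gromovProduct_comm]
  exact gromovProduct_le_dist_left o y x

/-- The source of all dichotomies below: a product that is small seen from `p` is large seen from
`q` when `p` and `q` are far apart. -/
theorem gromovProduct_add_gromovProduct (p q x : S) :
    gromovProduct p x q + gromovProduct q x p = dist p q := by
  unfold gromovProduct
  rw [dist_comm q p]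
  ring

theorem gromovProduct_sub_dist_le (o o' x y : S) :
    gromovProduct o x y - dist o o' ≤ gromovProduct o' x y := by
  unfold gromovProduct
  linarith [dist_triangle x o' o, dist_triangle y o' o, dist_comm o o']

theorem gromovProduct_sub_dist_le_right (o x y y' : S) :
    gromovProduct o x y - dist y y' ≤ gromovProduct o x y' := by
  unfold gromovProduct
  linarith [dist_triangle y y' o, dist_triangle x y y']

theorem eventually_of_productDiverges {x y : ℕ → S} (h : ProductDiverges x y) (o : S) (r : ℝ) :
    ∃ N, ∀ i ≥ N, ∀ j ≥ N, r ≤ gromovProduct o (x i) (y j) := by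
  obtain ⟨N, hN⟩ := eventually_atTop.1 (tendsto_atTop.1 (h o) r)
  exact ⟨max N.1 N.2, fun i hi j hj => hN (i, j)
    ⟨(le_max_left _ _).trans hi, (le_max_right _ _).trans hj⟩⟩

variable [HyperbolicSpace S]

/-- The sequence `x` represents the point `s` of `S ∪ ∂S`: it is constant, respectively converges
at infinity to `s`. -/
def Represents (x : ℕ → S) : Bordification S → Prop
  | .pt z => ∀ i, x i = z
  | .bd a => ∃ h : ProductDiverges x x, ConvergesTo ⟨x, h⟩ a

/-- Eventually `⟨x_i | y_j⟩_o ≥ r`, for all sequences representing `s` and `t`. -/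
def ProdGE (o : S) (s t : Bordification S) (r : ℝ) : Prop :=
  ∀ x y : ℕ → S, Represents x s → Represents y t →
    ∃ N, ∀ i ≥ N, ∀ j ≥ N, r ≤ gromovProduct o (x i) (y j)

theorem exists_represents (s : Bordification S) : ∃ x : ℕ → S, Represents x s := by
  cases s with
  | pt z => exact ⟨fun _ => z, fun _ => rfl⟩
  | bd a =>
    induction a using Quotient.inductionOn with
    | h x => exact ⟨x.1, x.2, rfl⟩

theorem productDiverges_of_represents {x y : ℕ → S} {a : GromovBoundary S}
    (hx : Represents x (.bd a)) (hy : Represents y (.bd a)) : ProductDiverges x y := by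
  obtain ⟨hx, h1⟩ := hx
  obtain ⟨hy, h2⟩ := hy
  exact Quotient.exact (h1.trans h2.symm)

theorem ProdGE.mono {o : S} {s t : Bordification S} {r r' : ℝ} (h : ProdGE o s t r)
    (hr : r' ≤ r) : ProdGE o s t r' := fun x y hx hy => by
  obtain ⟨N, hN⟩ := h x y hx hy
  exact ⟨N, fun i hi j hj => hr.trans (hN i hi j hj)⟩

theorem ProdGE.symm {o : S} {s t : Bordification S} {r : ℝ} (h : ProdGE o s t r) :
    ProdGE o t s r := fun x y hx hy => by
  obtain ⟨N, hN⟩ := h y x hy hx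
  exact ⟨N, fun i hi j hj => by rw [gromovProduct_comm]; exact hN j hj i hi⟩

theorem ProdGE.trans {δ : ℝ} (hδ : IsDeltaHyperbolic S δ) {o : S} {s t u : Bordification S}
    {r : ℝ} (h1 : ProdGE o s t r) (h2 : ProdGE o t u r) : ProdGE o s u (r - δ) := by
  intro x z hx hz
  obtain ⟨y, hy⟩ := exists_represents t
  obtain ⟨N, hN⟩ := h1 x y hx hy
  obtain ⟨M, hM⟩ := h2 y z hy hz
  refine ⟨max N M, fun i hi j hj => ?_⟩
  have e1 := hN i ((le_max_left _ _).trans hi) (max N M) (le_max_left _ _)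
  have e2 := hM (max N M) (le_max_right _ _) j ((le_max_right _ _).trans hj)
  linarith [hδ (x i) (z j) (y (max N M)) o, le_min e1 e2]

theorem ProdGE.change_base {o : S} {s t : Bordification S} {r : ℝ} (h : ProdGE o s t r) (o' : S) :
    ProdGE o' s t (r - dist o o') := fun x y hx hy => by
  obtain ⟨N, hN⟩ := h x y hx hy
  exact ⟨N, fun i hi j hj => by
    linarith [hN i hi j hj, gromovProduct_sub_dist_le o o' (x i) (y j)]⟩

theorem prodGE_pt_pt {o y z : S} {r : ℝ} :
    ProdGE o (.pt y) (.pt z) r ↔ r ≤ gromovProduct o y z := by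
  constructor
  · intro h
    obtain ⟨N, hN⟩ := h (fun _ => y) (fun _ => z) (fun _ => rfl) (fun _ => rfl)
    exact hN N le_rfl N le_rfl
  · intro h x x' hx hx'
    refine ⟨0, fun i _ j _ => ?_⟩
    rw [hx i, hx' j]
    exact h

theorem ProdGE.le_dist {o z : S} {s : Bordification S} {r : ℝ} (h : ProdGE o s (.pt z) r) :
    r ≤ dist z o := by
  obtain ⟨x, hx⟩ := exists_represents s
  obtain ⟨N, hN⟩ := h x (fun _ => z) hx (fun _ => rfl)
  exact (hN N le_rfl N le_rfl).trans (gromovProduct_le_dist_right _ _ _)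

theorem ProdGE.change_pt {o z : S} {s : Bordification S} {r : ℝ} (h : ProdGE o s (.pt z) r)
    (z' : S) : ProdGE o s (.pt z') (r - dist z z') := fun x y hx hy => by
  obtain ⟨N, hN⟩ := h x (fun _ => z) hx (fun _ => rfl)
  exact ⟨N, fun i hi j hj => by
    rw [hy j]
    linarith [hN i hi j hj, gromovProduct_sub_dist_le_right o (x i) z z']⟩

theorem prodGE_bd_self (o : S) (a : GromovBoundary S) (r : ℝ) : ProdGE o (.bd a) (.bd a) r :=
  fun _ _ hx hy => eventually_of_productDiverges (productDiverges_of_represents hx hy) o r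

theorem exists_not_prodGE (o : S) {a b : GromovBoundary S} (hab : a ≠ b) :
    ∃ r, ¬ ProdGE o (.bd a) (.bd b) r := by
  by_contra! h
  obtain ⟨x, hx⟩ := exists_represents (.bd a)
  obtain ⟨y, hy⟩ := exists_represents (.bd b)
  refine hab ?_
  obtain ⟨hx', rfl⟩ := id hx
  obtain ⟨hy', rfl⟩ := id hy
  refine Quotient.sound fun o' => tendsto_atTop.2 fun r => ?_
  obtain ⟨N, hN⟩ := (h (r + dist o o')).change_base o' x y hx hy
  exact eventually_atTop.2 ⟨(N, N), fun p hp => by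
    have := hN p.1 hp.1 p.2 hp.2
    simpa using this⟩

theorem represents_close {x x' y : ℕ → S} {s : Bordification S} (hx : Represents x s)
    (hx' : Represents x' s) {o : S} {r : ℝ}
    (h : ∀ N, ∃ i ≥ N, ∃ j ≥ N, r ≤ gromovProduct o (x i) (y j)) :
    ∃ N, ∀ i ≥ N, ∀ j ≥ N, r ≤ gromovProduct o (x' i) (x j) := by
  cases s with
  | bd a => exact eventually_of_productDiverges (productDiverges_of_represents hx' hx) o r
  | pt z =>
    refine ⟨0, fun i _ j _ => ?_⟩
    obtain ⟨k, -, l, -, hr⟩ := h 0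
    rw [hx k] at hr
    rw [hx' i, hx j]
    refine hr.trans ((gromovProduct_le_dist_left _ _ _).trans ?_)
    simp [gromovProduct]

/-- One pair of representatives with frequently large products controls all pairs: two uses of the
four-point condition replace `x` by `x'` and `y` by `y'`, each at the cost of `δ`. -/
theorem prodGE_of_frequently {δ : ℝ} (hδ : IsDeltaHyperbolic S δ) {x y : ℕ → S}
    {s t : Bordification S} (hx : Represents x s) (hy : Represents y t) {o : S} {r : ℝ}
    (h : ∀ N, ∃ i ≥ N, ∃ j ≥ N, r ≤ gromovProduct o (x i) (y j)) :
    ProdGE o s t (r - 2 * δ) := by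
  intro x' y' hx' hy'
  have h' : ∀ N, ∃ i ≥ N, ∃ j ≥ N, r ≤ gromovProduct o (y i) (x j) := fun N => by
    obtain ⟨i, hi, j, hj, hr⟩ := h N
    exact ⟨j, hj, i, hi, by rwa [gromovProduct_comm]⟩
  obtain ⟨N, hN⟩ := represents_close hx hx' h
  obtain ⟨M, hM⟩ := represents_close hy hy' h'
  obtain ⟨k, hk, l, hl, hr⟩ := h (max N M)
  refine ⟨max N M, fun i hi j hj => ?_⟩
  have e1 := hN i ((le_max_left _ _).trans hi) k ((le_max_left _ _).trans hk)
  have e2 := hM j ((le_max_right _ _).trans hj) l ((le_max_right _ _).trans hl)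
  rw [gromovProduct_comm] at e2
  have e3 := hδ (x' i) (y l) (x k) o
  have e4 := hδ (x' i) (y' j) (y l) o
  have e5 := le_min e1 hr
  have e6 : r - δ ≤ min (gromovProduct o (x' i) (y l)) (gromovProduct o (y l) (y' j)) :=
    le_min (by linarith) (by linarith [hδ.nonneg o])
  linarith

theorem prodGE_of_not_prodGE {δ : ℝ} (hδ : IsDeltaHyperbolic S δ) {p q : S} {s : Bordification S}
    {r : ℝ} (h : ¬ ProdGE p s (.pt q) r) : ProdGE q s (.pt p) (dist p q - r - 2 * δ) := by
  simp only [ProdGE] at h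
  push Not at h
  obtain ⟨x, y, hx, hy, h⟩ := h
  have hp : Represents (fun _ : ℕ => p) (.pt p) := fun _ => rfl
  refine prodGE_of_frequently hδ hx hp fun N => ?_
  obtain ⟨i, hi, j, hj, hr⟩ := h N
  rw [hy j] at hr
  exact ⟨i, hi, j, hj, by
    linarith [gromovProduct_add_gromovProduct p q (x i)]⟩

/-! ### Comparison with the topology of the bordification -/

theorem prodGE_of_lt_bdProduct {o : S} {a : GromovBoundary S} {s : Bordification S} {r : ℝ}
    (h : (r : EReal) < bdProduct o a s) : ProdGE o (.bd a) s r := by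
  intro x y hx hy
  obtain ⟨hx, hxa⟩ := hx
  cases s with
  | pt z =>
    have h1 := h.trans_le (iInf₂_le (⟨x, hx⟩ : SeqAtInfinity S) hxa)
    obtain ⟨N, hN⟩ := eventually_atTop.1 (eventually_lt_of_lt_liminf h1)
    refine ⟨N, fun i hi j _ => ?_⟩
    rw [hy j]
    exact (EReal.coe_lt_coe_iff.1 (hN i hi)).le
  | bd b =>
    obtain ⟨hy, hyb⟩ := hy
    have h1 := (h.trans_le (iInf₂_le (⟨x, hx⟩ : SeqAtInfinity S) hxa)).trans_le
      (iInf₂_le (⟨y, hy⟩ : SeqAtInfinity S) hyb)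
    obtain ⟨N, hN⟩ := eventually_atTop.1 (eventually_lt_of_lt_liminf h1)
    refine ⟨max N.1 N.2, fun i hi j hj => ?_⟩
    exact (EReal.coe_lt_coe_iff.1 (hN (i, j) ⟨(le_max_left _ _).trans hi,
      (le_max_right _ _).trans hj⟩)).le

theorem ProdGE.le_bdProduct {o : S} {a : GromovBoundary S} {s : Bordification S} {r : ℝ}
    (h : ProdGE o (.bd a) s r) : (r : EReal) ≤ bdProduct o a s := by
  cases s with
  | pt z =>
    refine le_iInf₂ fun x hx => ?_
    obtain ⟨N, hN⟩ := h x.1 (fun _ => z) ⟨x.2, hx⟩ (fun _ => rfl)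
    refine le_liminf_of_le (by isBoundedDefault) (eventually_atTop.2 ⟨N, fun i hi => ?_⟩)
    exact EReal.coe_le_coe_iff.2 (hN i hi N le_rfl)
  | bd b =>
    refine le_iInf₂ fun x hx => le_iInf₂ fun y hy => ?_
    obtain ⟨N, hN⟩ := h x.1 y.1 ⟨x.2, hx⟩ ⟨y.2, hy⟩
    refine le_liminf_of_le (by isBoundedDefault) (eventually_atTop.2 ⟨(N, N), fun p hp => ?_⟩)
    exact EReal.coe_le_coe_iff.2 (hN p.1 hp.1 p.2 hp.2)

/-- The sets `{s | ProdGE o a s r}` form a neighbourhood base at the boundary point `a`. -/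
theorem mem_nhds_bd_iff (o : S) (a : GromovBoundary S) (N : Set (Bordification S)) :
    N ∈ 𝓝 (Bordification.bd a) ↔ ∃ r : ℝ, ∀ s, ProdGE o (.bd a) s r → s ∈ N := by
  constructor
  · intro h
    obtain ⟨W, hWN, hW, ha⟩ := mem_nhds_iff.1 h
    obtain ⟨r, hr⟩ := hW.2 a ha o
    refine ⟨r + 1, fun s hs => hWN (hr ?_)⟩
    -- The extra `1` turns the weak bound from `ProdGE` into the strict one defining `bdNhd`.
    exact lt_of_lt_of_le (EReal.coe_lt_coe_iff.2 (by linarith)) hs.le_bdProduct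
  · rintro ⟨r, hr⟩
    obtain ⟨δ, hδ⟩ := HyperbolicSpace.hyperbolic (S := S)
    -- The candidate for the interior of `N`: the points having a whole basic neighbourhood inside
    -- `N`.
    let P : Bordification S → Prop := fun s => match s with
      | .pt z => ∃ ε > 0, ∀ z' : S, dist z' z < ε → Bordification.pt z' ∈ N
      | .bd b => ∃ r : ℝ, ∀ s, ProdGE o (.bd b) s r → s ∈ N
    refine mem_nhds_iff.2 ⟨{s | P s}, ?_, ⟨?_, ?_⟩, ⟨r, hr⟩⟩
    · rintro (z | b) hs
      · obtain ⟨ε, hε, h⟩ := hs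
        exact h z (by simpa using hε)
      · obtain ⟨r', h⟩ := hs
        exact h _ (prodGE_bd_self o b r')
    · refine Metric.isOpen_iff.2 fun z hz => ?_
      obtain ⟨ε, hε, h⟩ := hz
      refine ⟨ε / 2, by positivity, fun z' hz' => ⟨ε / 2, by positivity, fun z'' hz'' => h z'' ?_⟩⟩
      rw [Metric.mem_ball] at hz'
      linarith [dist_triangle z'' z' z]
    · rintro b ⟨r', hb⟩ o'
      -- `dist o' o` pays for the change of base point, `1` for moving a point of `S` within its
      -- unit ball, and `δ` for hyperbolicity at a boundary point.
      refine ⟨r' + δ + 1 + dist o' o, fun s hs => ?_⟩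
      have h1 : ProdGE o (.bd b) s (r' + δ + 1) :=
        ((prodGE_of_lt_bdProduct hs).change_base o).mono (by linarith)
      cases s with
      | pt z =>
        refine ⟨1, one_pos, fun z' hz' => hb _ ((h1.change_pt z').mono ?_)⟩
        rw [dist_comm] at hz'
        linarith [hδ.nonneg o]
      | bd c =>
        exact ⟨r' + δ, fun t ht => hb t (((h1.mono (by linarith)).trans hδ ht).mono (by linarith))⟩

theorem mem_nhds_boundary_iff (o : S) (a : GromovBoundary S) (N : Set (GromovBoundary S)) :
    N ∈ 𝓝 a ↔ ∃ r : ℝ, ∀ c, ProdGE o (.bd a) (.bd c) r → c ∈ N := by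
  rw [nhds_induced, mem_comap]
  constructor
  · rintro ⟨M, hM, hMN⟩
    obtain ⟨r, hr⟩ := (mem_nhds_bd_iff o a M).1 hM
    exact ⟨r, fun c hc => hMN (hr _ hc)⟩
  · rintro ⟨r, hr⟩
    exact ⟨{s | ProdGE o (.bd a) s r}, (mem_nhds_bd_iff o a _).2 ⟨r, fun s hs => hs⟩, fun c hc => hr c hc⟩

theorem nonempty_of_boundary (a : GromovBoundary S) : Nonempty S := by
  obtain ⟨x, -⟩ := exists_represents (.bd a)
  exact ⟨x 0⟩

instance t2Space_gromovBoundary : T2Space (GromovBoundary S) := by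
  refine t2Space_iff_disjoint_nhds.2 fun a b hab => ?_
  obtain ⟨δ, hδ⟩ := HyperbolicSpace.hyperbolic (S := S)
  obtain ⟨o⟩ := nonempty_of_boundary a
  obtain ⟨r, hr⟩ := exists_not_prodGE o hab
  refine Filter.disjoint_iff.2 ⟨_, (mem_nhds_boundary_iff o a _).2 ⟨r + δ, fun c hc => hc⟩, _,
    (mem_nhds_boundary_iff o b _).2 ⟨r + δ, fun c hc => hc⟩, ?_⟩
  refine Set.disjoint_left.2 fun c (h1 : ProdGE _ _ _ _) (h2 : ProdGE _ _ _ _) => hr ?_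
  exact (h1.trans hδ h2.symm).mono (by linarith)

end Products

/-! ### Isometric actions -/

section Action

variable {G : Type u} [Group G] {S : Type v} [MetricSpace S] [MulAction G S] [IsIsometricSMul G S]
  [HyperbolicSpace S]

/-- The action on `S ∪ ∂S`. -/
instance bordificationSMul : SMul G (Bordification S) where
  smul g s := match s with
    | .pt z => .pt (g • z)
    | .bd a => .bd (g • a)

theorem smul_pt (g : G) (z : S) : g • (Bordification.pt z) = .pt (g • z) := rfl

theorem smul_bd (g : G) (a : GromovBoundary S) : g • (Bordification.bd a) = .bd (g • a) := rfl

theorem Represents.smul {x : ℕ → S} {s : Bordification S} (h : Represents x s) (g : G) :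
    Represents (fun i => g • x i) (g • s) := by
  cases s with
  | pt z => exact fun i => congrArg (g • ·) (h i)
  | bd a =>
    obtain ⟨hx, rfl⟩ := h
    exact ⟨hx.smul g, rfl⟩

theorem ProdGE.smul {o : S} {s t : Bordification S} {r : ℝ} (h : ProdGE o s t r) (g : G) :
    ProdGE (g • o) (g • s) (g • t) r := by
  intro x y hx hy
  have hinv : ∀ s : Bordification S, g⁻¹ • g • s = s := by
    rintro (z | a)
    · exact congrArg Bordification.pt (inv_smul_smul g z)
    · exact congrArg Bordification.bd (inv_smul_smul g a)
  obtain ⟨N, hN⟩ := h _ _ (hinv s ▸ hx.smul g⁻¹) (hinv t ▸ hy.smul g⁻¹)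
  refine ⟨N, fun i hi j hj => ?_⟩
  have := hN i hi j hj
  rwa [gromovProduct_smul, inv_inv] at this

instance continuousConstSMul_gromovBoundary : ContinuousConstSMul G (GromovBoundary S) where
  continuous_const_smul g := by
    refine continuous_iff_continuousAt.2 fun a N hN => ?_
    obtain ⟨o⟩ := nonempty_of_boundary a
    obtain ⟨r, hr⟩ := (mem_nhds_boundary_iff (g • o) _ N).1 hN
    exact (mem_nhds_boundary_iff o a _).2 ⟨r, fun c hc => hr _ (hc.smul g)⟩

variable (G) in
theorem mem_limitSet_iff (o : S) (a : GromovBoundary S) :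
    a ∈ limitSet G S ↔ ∀ r : ℝ, ∃ g : G, ProdGE o (.bd a) (.pt (g • o)) r := by
  constructor
  · rintro ⟨s, hs⟩ r
    obtain ⟨_, h, _, ⟨g, rfl⟩, rfl⟩ := mem_closure_iff_nhds.1 hs
      {t | ProdGE o (.bd a) t (r + dist s o)} ((mem_nhds_bd_iff o a _).2 ⟨_, fun _ h => h⟩)
    refine ⟨g, (ProdGE.change_pt h (g • o)).mono ?_⟩
    simp only [dist_smul]
    linarith
  · intro h
    refine ⟨o, mem_closure_iff_nhds.2 fun N hN => ?_⟩
    obtain ⟨r, hr⟩ := (mem_nhds_bd_iff o a N).1 hN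
    obtain ⟨g, hg⟩ := h r
    exact ⟨_, hr _ hg, _, ⟨g, rfl⟩, rfl⟩

theorem smul_mem_limitSet (g : G) {a : GromovBoundary S} (ha : a ∈ limitSet G S) :
    g • a ∈ limitSet G S := by
  obtain ⟨o⟩ := nonempty_of_boundary a
  rw [mem_limitSet_iff G o] at ha ⊢
  intro r
  obtain ⟨k, hk⟩ := ha (r + dist (g • o) o)
  have h := ((hk.smul g).change_base o).mono (r' := r) (by linarith)
  exact ⟨g * k, by rwa [mul_smul]⟩

/-- The induced action on the limit set. -/
instance limitSetAction : MulAction G (limitSet G S) where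
  smul g a := ⟨g • (a : GromovBoundary S), smul_mem_limitSet g a.2⟩
  one_smul a := Subtype.ext (one_smul G (a : GromovBoundary S))
  mul_smul g h a := Subtype.ext (mul_smul g h (a : GromovBoundary S))

theorem coe_limitSet_smul (g : G) (a : limitSet G S) :
    ((g • a : limitSet G S) : GromovBoundary S) = g • (a : GromovBoundary S) := rfl

instance continuousConstSMul_limitSet : ContinuousConstSMul G (limitSet G S) where
  continuous_const_smul g :=
    ((continuous_const_smul g).comp continuous_subtype_val).subtype_mk _

/-! ### Loxodromic elements -/

/-- North-south dynamics of powers of an element with unbounded orbits and two fixed points. -/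
theorem exists_zpow_prodGE {δ : ℝ} (hδ : IsDeltaHyperbolic S δ) (o : S) {g : G}
    (hg : ¬ Bornology.IsBounded (Set.range fun n : ℤ => g ^ n • o)) {a b : GromovBoundary S}
    (hab : a ≠ b) (ha : g • a = a) (hb : g • b = b) (R : ℝ) :
    ∃ n : ℤ, ProdGE o (.bd a) (.pt (g ^ n • o)) R ∧ ProdGE o (.bd b) (.pt ((g ^ n)⁻¹ • o)) R := by
  obtain ⟨D, hD⟩ := exists_not_prodGE o hab
  -- The first bound yields the final constant `R`; the second makes the product at `g ^ n • o` at
  -- least `D + δ`, so that it can exclude the other fixed point.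
  obtain ⟨n, hn⟩ : ∃ n : ℤ, max (R + D + 3 * δ) (2 * D + 4 * δ) ≤ dist o (g ^ n • o) := by
    by_contra! h
    refine hg ((Metric.isBounded_closedBall (x := o)
      (r := max (R + D + 3 * δ) (2 * D + 4 * δ))).subset ?_)
    rintro _ ⟨n, rfl⟩
    rw [Metric.mem_closedBall, dist_comm]
    exact (h n).le
  have hn1 := (le_max_left _ _).trans hn
  have hn2 := (le_max_right _ _).trans hn
  have ha' : ∀ m : ℤ, g ^ m • a = a := fun m =>
    (MulAction.stabilizer G a).zpow_mem (MulAction.mem_stabilizer_iff.2 ha) m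
  have hb' : ∀ m : ℤ, g ^ m • b = b := fun m =>
    (MulAction.stabilizer G b).zpow_mem (MulAction.mem_stabilizer_iff.2 hb) m
  have hshift : ∀ c : GromovBoundary S, (∀ m : ℤ, g ^ m • c = c) → ∀ r,
      ProdGE (g ^ n • o) (.bd c) (.pt o) r → ProdGE o (.bd c) (.pt ((g ^ n)⁻¹ • o)) r := by
    intro c hc r h
    have h1 := h.smul (g ^ n)⁻¹
    rwa [inv_smul_smul, smul_bd, ← zpow_neg, hc, smul_pt, zpow_neg] at h1
  have hD' : ¬ ProdGE (g ^ n • o) (.bd a) (.bd b) D := fun h => hD (by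
    have h1 := h.smul (g ^ n)⁻¹
    rwa [inv_smul_smul, smul_bd, smul_bd, ← zpow_neg, ha', hb'] at h1)
  -- If `g ^ n • o` is not towards `c` from `o`, then `o` is towards `c` from `g ^ n • o`. There `o`
  -- cannot also be towards `d`, so from `o` the point `g ^ n • o` is towards `d`.
  have key : ∀ c d : GromovBoundary S, ¬ ProdGE (g ^ n • o) (.bd c) (.bd d) D →
      ¬ ProdGE o (.bd c) (.pt (g ^ n • o)) (D + δ) →
      ProdGE (g ^ n • o) (.bd c) (.pt o) R ∧ ProdGE o (.bd d) (.pt (g ^ n • o)) R := by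
    intro c d hcd hc
    have h1 := prodGE_of_not_prodGE hδ hc
    refine ⟨h1.mono (by linarith), ?_⟩
    have h2 : ¬ ProdGE (g ^ n • o) (.bd d) (.pt o) (D + δ) := fun h =>
      hcd (((h1.mono (by linarith)).trans hδ h.symm).mono (by linarith))
    have h3 := prodGE_of_not_prodGE hδ h2
    rw [dist_comm] at h3
    exact h3.mono (by linarith)
  -- The sign of `n` was not controlled; if `g ^ n • o` points away from `a`, the exponent `-n`
  -- works.
  by_cases h : ProdGE o (.bd a) (.pt (g ^ n • o)) (D + δ)
  · have h' : ¬ ProdGE o (.bd b) (.pt (g ^ n • o)) (D + δ) := fun h' =>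
      hD ((h.trans hδ h'.symm).mono (by linarith))
    obtain ⟨h1, h2⟩ := key b a (fun h => hD' h.symm) h'
    exact ⟨n, h2, hshift b hb' R h1⟩
  · obtain ⟨h1, h2⟩ := key a b hD' h
    refine ⟨-n, ?_, ?_⟩
    · rw [zpow_neg]
      exact hshift a ha' R h1
    · rwa [zpow_neg, inv_inv]

/-- As `y` is away from the repelling point `b`, its image `k • y` is towards `a`. Since `y` is away
from `a`, the two directions differ. -/
theorem gromovProduct_smul_lt {δ : ℝ} (hδ : IsDeltaHyperbolic S δ) {o : S} {k : G}
    {a b : GromovBoundary S} (hb : k • b = b) {R : ℝ} (hR : 0 ≤ R)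
    (h1 : ProdGE o (.bd a) (.pt (k • o)) (2 * R + 3 * δ))
    (h2 : ProdGE o (.bd b) (.pt (k⁻¹ • o)) (2 * R + 3 * δ)) {y : S}
    (hya : ¬ ProdGE o (.bd a) (.pt y) R) (hyb : ¬ ProdGE o (.bd b) (.pt y) R) :
    gromovProduct o y (k • y) < R + δ := by
  have hδ0 := hδ.nonneg o
  by_contra! hcon
  have h3 : ProdGE (k • o) (.bd b) (.pt o) (2 * R + 3 * δ) := by
    have := h2.smul k
    rwa [smul_bd, smul_pt, hb, smul_inv_smul] at this
  have h4 : ¬ ProdGE (k • o) (.bd b) (.pt (k • y)) R := fun h => hyb (by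
    have h5 := h.smul k⁻¹
    rwa [smul_bd, smul_pt, inv_smul_smul, inv_smul_smul, inv_smul_eq_iff.2 hb.symm] at h5)
  have h5 : gromovProduct (k • o) o (k • y) < R + δ := by
    by_contra! h
    exact h4 (((h3.mono (by linarith)).trans hδ (prodGE_pt_pt.2 h)).mono (by linarith))
  have h6 := gromovProduct_add_gromovProduct o (k • o) (k • y)
  have h7 := h1.le_dist
  rw [dist_comm] at h7
  rw [gromovProduct_comm _ (k • y) o, gromovProduct_comm _ (k • y)] at h6
  have h8 : ProdGE o (.pt (k • o)) (.pt (k • y)) (R + 2 * δ) := prodGE_pt_pt.2 (by linarith)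
  have h9 := (h1.mono (by linarith)).trans hδ h8
  exact hya (((h9.mono (r' := R + δ) (by linarith)).trans hδ
    (prodGE_pt_pt.2 (by rwa [gromovProduct_comm]))).mono (by linarith))

end Action

/-! ### General type actions and extreme proximality on the limit set. -/

section GeneralType

variable {G : Type u} [Group G] {S : Type v} [MetricSpace S] [MulAction G S] [IsIsometricSMul G S]
  [HyperbolicSpace S]

theorem exists_fixed_points_of_isLoxodromic {g : G} (hg : IsLoxodromic S g) :
    ∃ a b : GromovBoundary S, a ≠ b ∧ MulAction.fixedBy (GromovBoundary S) g = {a, b} :=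
  Set.ncard_eq_two.1 hg.2

theorem mem_limitSet_of_isLoxodromic {g : G} (hg : IsLoxodromic S g) {a : GromovBoundary S}
    (ha : a ∈ MulAction.fixedBy (GromovBoundary S) g) : a ∈ limitSet G S := by
  obtain ⟨δ, hδ⟩ := HyperbolicSpace.hyperbolic (S := S)
  obtain ⟨o⟩ := nonempty_of_boundary a
  obtain ⟨b, c, hbc, h⟩ := exists_fixed_points_of_isLoxodromic hg
  obtain ⟨d, hd, had⟩ : ∃ d ∈ MulAction.fixedBy (GromovBoundary S) g, a ≠ d := by
    rw [h] at ha ⊢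
    rcases ha with rfl | rfl
    exacts [⟨c, by simp, hbc⟩, ⟨b, by simp, hbc.symm⟩]
  refine (mem_limitSet_iff G o a).2 fun r => ?_
  obtain ⟨n, hn, -⟩ := exists_zpow_prodGE hδ o (hg.1 o) had ha hd r
  exact ⟨_, hn⟩

/-- Three distinct points in the limit set of an action of general type. -/
theorem exists_ne_ne_of_isGeneralType (hG : IsGeneralType G S) (p : limitSet G S) :
    ∃ x y : limitSet G S, x ≠ p ∧ y ≠ p ∧ x ≠ y := by
  obtain ⟨-, g, h, hg, hh, hdisj⟩ := hG
  obtain ⟨a, b, hab, hgab⟩ := exists_fixed_points_of_isLoxodromic hg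
  obtain ⟨c, d, hcd, hhcd⟩ := exists_fixed_points_of_isLoxodromic hh
  have ha : a ∈ MulAction.fixedBy (GromovBoundary S) g := by simp [hgab]
  have hb : b ∈ MulAction.fixedBy (GromovBoundary S) g := by simp [hgab]
  have hc : c ∈ MulAction.fixedBy (GromovBoundary S) h := by simp [hhcd]
  have hac : a ≠ c := fun h => Set.disjoint_left.1 hdisj ha (h ▸ hc)
  have hbc : b ≠ c := fun h => Set.disjoint_left.1 hdisj hb (h ▸ hc)
  have hne : ∀ {x y : GromovBoundary S} (hx : x ∈ limitSet G S) (hy : y ∈ limitSet G S), x ≠ y →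
      (⟨x, hx⟩ : limitSet G S) ≠ ⟨y, hy⟩ := fun _ _ h h' => h (congrArg Subtype.val h')
  have ha' := mem_limitSet_of_isLoxodromic hg ha
  have hb' := mem_limitSet_of_isLoxodromic hg hb
  have hc' := mem_limitSet_of_isLoxodromic hh hc
  by_cases hpa : (⟨a, ha'⟩ : limitSet G S) = p
  · subst hpa
    exact ⟨⟨b, hb'⟩, ⟨c, hc'⟩, hne _ _ hab.symm, hne _ _ hac.symm, hne _ _ hbc⟩
  · by_cases hpb : (⟨b, hb'⟩ : limitSet G S) = p
    · subst hpb
      exact ⟨⟨a, ha'⟩, ⟨c, hc'⟩, hne _ _ hab, hne _ _ hbc.symm, hne _ _ hac⟩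
    · exact ⟨⟨a, ha'⟩, ⟨b, hb'⟩, hpa, hpb, hne _ _ hab⟩

/-- Some power of a loxodromic element moves every point that is not close to one of its fixed
points into an essentially different direction. -/
theorem exists_gromovProduct_smul_lt {δ : ℝ} (hδ : IsDeltaHyperbolic S δ) (o : S) {g : G}
    (hg : IsLoxodromic S g) {R : ℝ} (hR : 0 ≤ R) :
    ∃ k : G, ∀ y : S, R + δ ≤ gromovProduct o y (k • y) →
      ∃ a ∈ MulAction.fixedBy (GromovBoundary S) g, ProdGE o (.bd a) (.pt y) R := by
  obtain ⟨a, b, hab, h⟩ := exists_fixed_points_of_isLoxodromic hg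
  have ha : a ∈ MulAction.fixedBy (GromovBoundary S) g := by simp [h]
  have hb : b ∈ MulAction.fixedBy (GromovBoundary S) g := by simp [h]
  obtain ⟨n, h1, h2⟩ := exists_zpow_prodGE hδ o (hg.1 o) hab ha hb (2 * R + 3 * δ)
  refine ⟨g ^ n, fun y hy => ?_⟩
  by_contra! hcon
  have hbn : g ^ n • b = b :=
    (MulAction.stabilizer G b).zpow_mem (MulAction.mem_stabilizer_iff.2 hb) n
  exact absurd (gromovProduct_smul_lt hδ hbn hR h1 h2 (hcon a ha) (hcon b hb)) (not_lt.2 hy)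

/-- Finitely many pairs of distinct boundary points have a common bound on their products; one
further `δ` separates their neighbourhoods. -/
theorem exists_bound_not_prodGE {δ : ℝ} (hδ : IsDeltaHyperbolic S δ) (o : S)
    {s t : Set (GromovBoundary S)} (hs : s.Finite) (ht : t.Finite) (hst : Disjoint s t) :
    ∃ R ≥ 0, ∀ a ∈ s, ∀ b ∈ t, ∀ y : S, ProdGE o (.bd a) (.pt y) R →
      ¬ ProdGE o (.bd b) (.pt y) R := by
  have hD : ∀ q : GromovBoundary S × GromovBoundary S, ∃ r, q ∈ s ×ˢ t →
      ¬ ProdGE o (.bd q.1) (.bd q.2) r := by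
    intro q
    by_cases hq : q ∈ s ×ˢ t
    · obtain ⟨r, hr⟩ := exists_not_prodGE o
        (fun h => Set.disjoint_left.1 hst hq.1 (h ▸ hq.2) : q.1 ≠ q.2)
      exact ⟨r, fun _ => hr⟩
    · exact ⟨0, fun h => absurd h hq⟩
  choose D hD using hD
  obtain ⟨M, hM⟩ := ((hs.prod ht).image D).bddAbove
  refine ⟨max M 0 + δ, add_nonneg (le_max_right _ _) (hδ.nonneg o), fun a ha b hb y h1 h2 => ?_⟩
  refine hD (a, b) ⟨ha, hb⟩ ((h1.trans hδ h2.symm).mono ?_)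
  have := hM (Set.mem_image_of_mem D (⟨ha, hb⟩ : (a, b) ∈ s ×ˢ t))
  linarith [le_max_left M 0]

/-- For any two points, one of three fixed elements makes their Gromov product bounded. -/
theorem exists_gromovProduct_lt_of_isGeneralType (hG : IsGeneralType G S) (o : S) :
    ∃ (C : ℝ) (K : Set G), K.Finite ∧ ∀ y z : S, ∃ k ∈ K, gromovProduct o (k • y) z < C := by
  obtain ⟨δ, hδ⟩ := HyperbolicSpace.hyperbolic (S := S)
  obtain ⟨-, g, h, hg, hh, hdisj⟩ := hG
  have hfin : ∀ {k : G}, IsLoxodromic S k → (MulAction.fixedBy (GromovBoundary S) k).Finite :=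
    fun hk => Set.finite_of_ncard_ne_zero (by rw [hk.2]; norm_num)
  obtain ⟨R, hR, hdis⟩ := exists_bound_not_prodGE hδ o (hfin hg) (hfin hh) hdisj
  obtain ⟨k, hk⟩ := exists_gromovProduct_smul_lt hδ o hg hR
  obtain ⟨l, hl⟩ := exists_gromovProduct_smul_lt hδ o hh hR
  refine ⟨R + 2 * δ, {1, k, l}, by simp, fun y z => ?_⟩
  by_contra! hcon
  have h1 := hcon 1 (by simp)
  have h2 := hcon k (by simp)
  have h3 := hcon l (by simp)
  rw [one_smul] at h1
  rw [gromovProduct_comm] at h2 h3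
  -- If `y`, `k • y` and `l • y` all point towards `z`, then `y` is close to a fixed point of `g`
  -- and to one of `h`, which the choice of `R` excludes.
  obtain ⟨a, ha, hya⟩ := hk y (by linarith [hδ y (k • y) z o, le_min h1 h2])
  obtain ⟨b, hb, hyb⟩ := hl y (by linarith [hδ y (l • y) z o, le_min h1 h3])
  exact hdis a ha b hb y hya hyb

/-- Elements with prescribed approximate attracting and repelling points in the limit set. -/
theorem exists_prodGE_of_isGeneralType (hG : IsGeneralType G S) (o : S) {a b : GromovBoundary S}
    (ha : a ∈ limitSet G S) (hb : b ∈ limitSet G S) (R : ℝ) :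
    ∃ f : G, ProdGE o (.bd b) (.pt (f • o)) R ∧ ProdGE o (.bd a) (.pt (f⁻¹ • o)) R := by
  obtain ⟨δ, hδ⟩ := HyperbolicSpace.hyperbolic (S := S)
  obtain ⟨C, K, hK, hC⟩ := exists_gromovProduct_lt_of_isGeneralType hG o
  obtain ⟨E, hE⟩ := (hK.image fun k => dist o (k • o)).bddAbove
  have hbound := le_abs_self C
  have hbound' := le_abs_self E
  have hpos := abs_nonneg C
  have hpos' := abs_nonneg E
  obtain ⟨p, hp⟩ := (mem_limitSet_iff G o b).1 hb (R + |C| + |E| + δ)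
  obtain ⟨q, hq⟩ := (mem_limitSet_iff G o a).1 ha (R + |C| + |E| + δ)
  obtain ⟨k, hkK, hk⟩ := hC (q⁻¹ • o) (p⁻¹ • o)
  have hkE : dist o (k • o) ≤ E := hE (Set.mem_image_of_mem _ hkK)
  have hδ0 := hδ.nonneg o
  -- Seen from `o`, the product of `r • o` and `r • x` is `dist o (r⁻¹ • o)` minus the product of
  -- `x` and `r⁻¹ • o`. A bound on the latter keeps `r • x` in the direction of `r • o`.
  have hclose : ∀ (c : GromovBoundary S) (r : G) (x : S),
      ProdGE o (.bd c) (.pt (r • o)) (R + |C| + |E| + δ) →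
      gromovProduct o x (r⁻¹ • o) ≤ |C| + |E| → ProdGE o (.bd c) (.pt (r • x)) R := by
    intro c r x hc hx
    have h1 := gromovProduct_add_gromovProduct o (r⁻¹ • o) x
    have h2 := gromovProduct_smul r o o x
    have h3 : dist o (r⁻¹ • o) = dist (r • o) o := by rw [← dist_smul r, smul_inv_smul]
    rw [gromovProduct_comm o x, gromovProduct_comm _ x o] at h1
    rw [gromovProduct_comm] at hx
    have h4 : ProdGE o (.pt (r • o)) (.pt (r • x)) (R + δ) :=
      prodGE_pt_pt.2 (by linarith [hc.le_dist])
    exact ((hc.mono (by linarith)).trans hδ h4).mono (by linarith)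
  -- `p • o` is near `b`, `q • o` is near `a`, and `k` prevents cancellation between `p` and `q⁻¹`.
  refine ⟨p * k * q⁻¹, ?_, ?_⟩
  · rw [mul_smul, mul_smul]
    exact hclose b p _ hp (by linarith)
  · rw [mul_inv_rev, mul_inv_rev, inv_inv, mul_smul, mul_smul]
    refine hclose a q _ hq ?_
    -- For the inverse, translation by `k` returns to the same product based at `k • o`; the change
    -- of base point costs at most `E`.
    have h1 := gromovProduct_smul k (k • o) (k⁻¹ • p⁻¹ • o) (q⁻¹ • o)
    rw [smul_inv_smul, inv_smul_smul, gromovProduct_comm] at h1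
    linarith [gromovProduct_sub_dist_le (k • o) o (k • q⁻¹ • o) (p⁻¹ • o), dist_comm o (k • o),
      gromovProduct_sub_dist_le o (k • o) (k • q⁻¹ • o) (p⁻¹ • o)]

/-- A point `x` outside `U` is away from `a`, hence from the direction of `f⁻¹ • o`. So from `f⁻¹ •
o` it lies towards `o`; applying `f`, the point `f • x` lies towards `f • o` from `o`, that is,
towards `b`. -/
theorem isExtremelyProximal_of_isGeneralType (hG : IsGeneralType G S) :
    IsExtremelyProximal G (limitSet G S) := by
  rintro U V hU hV ⟨a, ha⟩ ⟨b, hb⟩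
  obtain ⟨δ, hδ⟩ := HyperbolicSpace.hyperbolic (S := S)
  obtain ⟨o⟩ := nonempty_of_boundary (a : GromovBoundary S)
  have hδ0 := hδ.nonneg o
  have hbase : ∀ (W : Set (limitSet G S)) (c : limitSet G S), IsOpen W → c ∈ W →
      ∃ r : ℝ, ∀ x : limitSet G S, ProdGE o (.bd c) (.bd x) r → x ∈ W := by
    intro W c hW hc
    obtain ⟨N, hN, hNW⟩ := mem_nhds_subtype _ _ _ |>.1 (hW.mem_nhds hc)
    obtain ⟨r, hr⟩ := (mem_nhds_boundary_iff o _ N).1 hN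
    exact ⟨r, fun x hx => hNW (hr _ hx)⟩
  obtain ⟨r, hr⟩ := hbase U a hU ha
  obtain ⟨s, hs⟩ := hbase V b hV hb
  obtain ⟨f, hfb, hfa⟩ := exists_prodGE_of_isGeneralType hG o a.2 b.2 (|r| + |s| + 4 * δ)
  refine ⟨f, fun x hx => hs _ ?_⟩
  have hr0 := le_abs_self r
  have hr1 := abs_nonneg r
  have hs0 := le_abs_self s
  have hs1 := abs_nonneg s
  have h1 : ¬ ProdGE o (.bd (x : GromovBoundary S)) (.pt (f⁻¹ • o)) (|r| + δ) := fun h =>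
    hx (hr x (((hfa.mono (by linarith)).trans hδ h.symm).mono (by linarith)))
  have h2 := (prodGE_of_not_prodGE hδ h1).smul f
  rw [smul_inv_smul, smul_bd, smul_pt] at h2
  have h3 := hfa.le_dist
  rw [dist_comm] at h3
  exact ((hfb.mono (r' := s + δ) (by linarith)).trans hδ (h2.symm.mono (by linarith))).mono
    (by linarith)

theorem FaithfulOnLimitSet.faithfulSMul (h : FaithfulOnLimitSet G S) :
    FaithfulSMul G (limitSet G S) where
  eq_of_smul_eq_smul {g k} hgk := by
    refine (inv_mul_eq_one.1 (h (k⁻¹ * g) fun a ha => ?_)).symm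
    rw [mul_smul, inv_smul_eq_iff]
    exact congrArg Subtype.val (hgk ⟨a, ha⟩)

end GeneralType

theorem isLimFree_and_isMIF_of_residuallyFinite (G : Type u) [Group G]
    (hG : IsFaithfulWeaklyHyperbolic.{u, v} G) [Group.ResiduallyFinite G] :
    IsLimFree.{u, v} G ∧ IsMIF G := by
  obtain ⟨S, _, _, _, _, hgen, hfaith⟩ := hG
  have := hfaith.faithfulSMul
  have hE := isExtremelyProximal_of_isGeneralType hgen
  have h3 := exists_ne_ne_of_isGeneralType hgen
  have hF : IsTopologicallyFree G (limitSet G S) := hE.isTopologicallyFree h3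
  have hne : Nonempty (limitSet G S) := by
    obtain ⟨-, g, -, hg, -, -⟩ := hgen
    obtain ⟨a, b, -, h⟩ := exists_fixed_points_of_isLoxodromic hg
    exact ⟨⟨a, mem_limitSet_of_isLoxodromic hg (by simp [h])⟩⟩
  refine ⟨⟨S, _, inferInstance, _, inferInstance, hgen, fun g hg => ?_⟩,
    isMIF_of_isTopologicallyFree hE h3 hF⟩
  simpa only [Subtype.ext_iff, coe_limitSet_smul] using hF g hg

end WeaklyHyperbolic

theorem mainTheorem6 (G : Type u) [Group G]
    (hG : WeaklyHyperbolic.IsFaithfulWeaklyHyperbolic.{u, v} G) :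
    (Group.ResiduallyFinite G →
      WeaklyHyperbolic.IsLimFree.{u, v} G ∧ WeaklyHyperbolic.IsMIF G) ∧
    (Group.FG G → WeaklyHyperbolic.IsLinearGroup.{u, w} G →
      WeaklyHyperbolic.IsLimFree.{u, v} G ∧ WeaklyHyperbolic.IsMIF G) := by
  refine ⟨fun _ => WeaklyHyperbolic.isLimFree_and_isMIF_of_residuallyFinite G hG, ?_⟩
  rintro _ ⟨F, _, n, ρ, hρ⟩
  have := residuallyFinite_of_fg_of_linear ρ hρ
  exact WeaklyHyperbolic.isLimFree_and_isMIF_of_residuallyFinite G hG
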